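/- Fix a finite set $I$ of agents and a finite set $J$ of basic propositions. A Kripke structure $\mathfrak M=(W,(E_i)_{i\in I},(P_j)_{j\in J})$ consists of a non-empty set $W$, binary relations $E_i\subseteq W\times W$ and subsets $P_j\subseteq W$; a pointed Kripke structure $\mathfrak M,w$ has in addition a distinguished $w\in W$. Write $E_i[u]=\{v\in W:(u,v)\in E_i\}$. The formulae of graded modal logic are built from $\top$ and the propositions $p_j$ ($j\in J$) by $\neg,\wedge,\vee$ and the modalities $\Diamond_i^{\geq k}$ ($i\in I$, $k\geq 1$), where $\mathfrak M,w\models p_j$ iff $w\in P_j$, where $\mathfrak M,w\models\Diamond_i^{\geq k}\psi$ iff $|\{u\in E_i[w]:\mathfrak M,u\models\psi\}|\geq k$, and where $\top,\neg,\wedge,\vee$ have their usual meaning. A graded bisimulation between $\mathfrak M$ and $\mathfrak M'=(W',(E'_i),(P'_j))$ is a non-empty relation $Z\subseteq W\times W'$ such that for all $(u,u')\in Z$: (a) $u\in P_j\Leftrightarrow u'\in P'_j$ for all $j$; (b) for all $i$, all $k\geq 1$ and all pairwise distinct $v_1,\dots,v_k\in E_i[u]$ there are pairwise distinct $v'_1,\dots,v'_k\in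 E'_i[u']$ with $(v_1,v'_1),\dots,(v_k,v'_k)\in Z$; (c) for all $i$, all $k\geq 1$ and all pairwise distinct $v'_1,\dots,v'_k\in E'_i[u']$ there are pairwise distinct $v_1,\dots,v_k\in E_i[u]$ with $(v_1,v'_1),\dots,(v_k,v'_k)\in Z$. The pointed structures $\mathfrak M,w$ and $\mathfrak M',w'$ are graded bisimilar if there is such a $Z$ with $(w,w')\in Z$. Theorem. Let $\varphi(x)$ be a formula of first-order logic with equality, with at most the free variable $x$, over the signature with binary relation symbols $E_i$ ($i\in I$) and unary relation symbols $P_j$ ($j\in J$). The following are equivalent: (i) $\varphi$ is invariant under graded bisimulation on all (finite or infinite) pointed Kripke structures: whenever $\mathfrak M,w$ and $\mathfrak M',w'$ are graded bisimilar, $\mathfrak M\models\varphi[w]$ iff $\mathfrak M'\models\varphi[w']$; (ii) there is a graded modal formula $\psi$ over $I,J$ that is logically equivalent to $\varphi$: for all pointed Kripke structures $\mathfrak M,w$, $\mathfrak M\models\varphi[w]$ iff $\mathfrak M,w\models\psi$. -/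

import Mathlib

universe u v x

/-- A Kripke structure on the set `W` of possible worlds, for the modal signature with agents `I`
and basic propositions `J`: one accessibility relation per agent and one unary predicate per basic
proposition. (In the presence of a distinguished world, `W` is automatically non-empty.) -/
structure KripkeStructure (I : Type*) (J : Type*) (W : Type*) where
  /-- `E i u v`: the world `v` is an `i`-successor of `u`. -/
  E : I → W → W → Prop
  /-- `P j u`: the basic proposition `j` holds at `u`. -/
  P : J → W → Prop

/-- Formulae of graded (multi-)modal logic. `dia i k φ` says that at least `k ≥ 1` of the
`i`-successors satisfy `φ`. -/
inductive GradedModalFormula (I : Type*) (J : Type*) where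
  | top : GradedModalFormula I J
  | prop (j : J) : GradedModalFormula I J
  | neg (φ : GradedModalFormula I J) : GradedModalFormula I J
  | and (φ ψ : GradedModalFormula I J) : GradedModalFormula I J
  | or (φ ψ : GradedModalFormula I J) : GradedModalFormula I J
  | dia (i : I) (k : ℕ) (hk : 1 ≤ k) (φ : GradedModalFormula I J) : GradedModalFormula I J

/-- Semantics of graded modal logic: `M, w ⊨ φ`. -/
def KripkeStructure.Sat {I J W : Type*} (M : KripkeStructure I J W) :
    W → GradedModalFormula I J → Prop
  | _, .top => True
  | w, .prop j => M.P j w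
  | w, .neg φ => ¬ M.Sat w φ
  | w, .and φ ψ => M.Sat w φ ∧ M.Sat w ψ
  | w, .or φ ψ => M.Sat w φ ∨ M.Sat w ψ
  | w, .dia i k _ φ => (k : ℕ∞) ≤ {u : W | M.E i w u ∧ M.Sat u φ}.encard

/-- The relation symbols of the first-order counterpart of a modal signature: a unary symbol for
each basic proposition and a binary symbol for each agent. -/
inductive ModalRelation (I : Type*) (J : Type*) : ℕ → Type _ where
  | prop (j : J) : ModalRelation I J 1
  | acc (i : I) : ModalRelation I J 2

/-- The purely relational first-order language of a modal signature (first-order logic has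
equality built in). -/
def modalLanguage (I : Type*) (J : Type*) : FirstOrder.Language where
  Functions := fun _ => Empty
  Relations := ModalRelation I J

/-- A Kripke structure as a first-order structure. -/
@[reducible]
def KripkeStructure.toStructure {I J W : Type*} (M : KripkeStructure I J W) :
    (modalLanguage I J).Structure W where
  funMap := fun f _ => Empty.elim f
  RelMap := fun {_} R xs =>
    match R, xs with
    | .prop j, xs => M.P j (xs 0)
    | .acc i, xs => M.E i (xs 0) (xs 1)

/-- First-order satisfaction `M, w ⊨ φ(x)`, the single free variable `x` being assigned `w`. -/
def KripkeStructure.SatFO {I J W : Type*} (M : KripkeStructure I J W) (w : W)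
    (φ : (modalLanguage I J).Formula (Fin 1)) : Prop :=
  letI := M.toStructure
  φ.Realize (fun _ => w)

/-- `Z` is a graded bisimulation relation between the Kripke structures `M` and `M'`. Tuples of `k`
pairwise distinct worlds are injective maps from `Fin k`. -/
structure IsGradedBisimulation {I J W W' : Type*} (M : KripkeStructure I J W)
    (M' : KripkeStructure I J W') (Z : W → W' → Prop) : Prop where
  nonempty : ∃ u u', Z u u'
  atoms : ∀ u u', Z u u' → ∀ j, M.P j u ↔ M'.P j u'
  forth : ∀ u u', Z u u' → ∀ (i : I) (k : ℕ), 1 ≤ k → ∀ v : Fin k → W,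
    Function.Injective v → (∀ a, M.E i u (v a)) →
      ∃ v' : Fin k → W', Function.Injective v' ∧ (∀ a, M'.E i u' (v' a)) ∧ ∀ a, Z (v a) (v' a)
  back : ∀ u u', Z u u' → ∀ (i : I) (k : ℕ), 1 ≤ k → ∀ v' : Fin k → W',
    Function.Injective v' → (∀ a, M'.E i u' (v' a)) →
      ∃ v : Fin k → W, Function.Injective v ∧ (∀ a, M.E i u (v a)) ∧ ∀ a, Z (v a) (v' a)

/-- The pointed Kripke structures `M, w` and `M', w'` are graded bisimilar. -/
def GradedBisimilar {I J W W' : Type*} (M : KripkeStructure I J W) (w : W)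
    (M' : KripkeStructure I J W') (w' : W') : Prop :=
  ∃ Z : W → W' → Prop, IsGradedBisimulation M M' Z ∧ Z w w'

/-!
The substantial direction is that invariance under graded bisimulation implies definability in
graded modal logic. It rests on finite approximations `GradedEquiv m` of graded bisimilarity: the
back-and-forth conditions are played for `m` rounds, and only tuples of length at most `m` may be
challenged.

* Each approximation is coarse: over finitely many agents and propositions, finitely many graded
  modal formulae suffice to guarantee `GradedEquiv m` (`exists_finite_forall_gradedEquiv`). The
  step from `m` to `m + 1` is a counting argument (`exists_matching_tuple`): a tuple of successors
  splits into classes according to the formulae of level `m` that hold, and the modalities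
  `◇^{≥ k}` transfer the size of each class. Hence a first-order formula invariant under some
  `GradedEquiv m` is a finite disjunction of characteristic formulae.
* If, on the other hand, `φ` is invariant under no `GradedEquiv m`, pick for each `n` pointed
  structures that are `n`-equivalent and disagree on `φ`. In the ultraproducts of the two sequences
  over a nonprincipal ultrafilter on `ℕ`, the relation "componentwise `m`-equivalent almost
  everywhere, for each `m`" is a graded bisimulation (`isGradedBisimulation_ultraproduct`): answers
  are found componentwise, in each component at the highest level that is available there. The
  ultraproducts are thus graded bisimilar, while by Łoś's theorem they disagree on `φ`.

As the index set is `ℕ`, the ultraproducts stay in the universe of the given structures, and no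
saturation or compactness beyond Łoś's theorem is needed.
-/

open Filter

/-! ### Tuples of distinct elements -/

theorem card_le_encard_iff_exists_injective {ι α : Type*} [Fintype ι] {s : Set α} :
    (Fintype.card ι : ℕ∞) ≤ s.encard ↔ ∃ f : ι → α, Function.Injective f ∧ ∀ a, f a ∈ s := by
  constructor
  · intro h
    obtain ⟨t, hts, ht⟩ := Set.exists_subset_encard_eq h
    have hfin : t.Finite := Set.finite_of_encard_eq_coe ht
    have : Fintype t := hfin.fintype
    have hcard : Fintype.card ι = Fintype.card t := by
      rw [Set.encard_eq_coe_toFinset_card, Set.toFinset_card] at ht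
      exact_mod_cast ht.symm
    let e := Fintype.equivOfCardEq hcard
    exact ⟨fun a => e a, Subtype.val_injective.comp e.injective, fun a => hts (e a).2⟩
  · rintro ⟨f, hf, hs⟩
    rw [← ENat.card_eq_coe_fintype_card, ← Set.encard_univ, ← hf.encard_image]
    exact Set.encard_le_encard (by rintro _ ⟨a, -, rfl⟩; exact hs a)

theorem natCast_le_encard_iff_exists_injective {α : Type*} {s : Set α} {k : ℕ} :
    (k : ℕ∞) ≤ s.encard ↔ ∃ f : Fin k → α, Function.Injective f ∧ ∀ a, f a ∈ s := by
  simpa using card_le_encard_iff_exists_injective (ι := Fin k) (s := s)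

/-! ### Graded modal formulae are invariant under graded bisimulation -/

theorem IsGradedBisimulation.sat_iff {I J W W' : Type*} {M : KripkeStructure I J W}
    {M' : KripkeStructure I J W'} {Z : W → W' → Prop} (hZ : IsGradedBisimulation M M' Z)
    (ψ : GradedModalFormula I J) {u : W} {u' : W'} (h : Z u u') : M.Sat u ψ ↔ M'.Sat u' ψ := by
  induction ψ generalizing u u' with
  | top => rfl
  | prop j => exact hZ.atoms u u' h j
  | neg ψ ih => exact not_congr (ih h)
  | and ψ χ ih₁ ih₂ => exact and_congr (ih₁ h) (ih₂ h)
  | or ψ χ ih₁ ih₂ => exact or_congr (ih₁ h) (ih₂ h)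
  | dia i k hk ψ ih =>
    simp only [KripkeStructure.Sat, natCast_le_encard_iff_exists_injective]
    constructor
    · rintro ⟨v, hv, hs⟩
      obtain ⟨v', hv', hE, hZv⟩ := hZ.forth u u' h i k hk v hv fun a => (hs a).1
      exact ⟨v', hv', fun a => ⟨hE a, (ih (hZv a)).1 (hs a).2⟩⟩
    · rintro ⟨v', hv', hs⟩
      obtain ⟨v, hv, hE, hZv⟩ := hZ.back u u' h i k hk v' hv' fun a => (hs a).1
      exact ⟨v, hv, fun a => ⟨hE a, (ih (hZv a)).2 (hs a).2⟩⟩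

/-! ### Finite approximations of graded bisimilarity -/

/-- The `m`-th approximation of graded bisimilarity: the back-and-forth conditions can be met for
`m` rounds, where in the round with `m` further rounds to come only tuples of at most `m + 1`
successors are challenged. Each level includes the preceding one, so that the approximations
decrease with `m` by definition. -/
def GradedEquiv {I J W W' : Type*} (M : KripkeStructure I J W) (M' : KripkeStructure I J W') :
    ℕ → W → W' → Prop
  | 0, u, u' => ∀ j, M.P j u ↔ M'.P j u'
  | m + 1, u, u' => GradedEquiv M M' m u u' ∧
      (∀ (i : I) (k : ℕ), k ≤ m + 1 → ∀ v : Fin k → W,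
        Function.Injective v → (∀ a, M.E i u (v a)) →
          ∃ v' : Fin k → W', Function.Injective v' ∧ (∀ a, M'.E i u' (v' a)) ∧
            ∀ a, GradedEquiv M M' m (v a) (v' a)) ∧
      (∀ (i : I) (k : ℕ), k ≤ m + 1 → ∀ v' : Fin k → W',
        Function.Injective v' → (∀ a, M'.E i u' (v' a)) →
          ∃ v : Fin k → W, Function.Injective v ∧ (∀ a, M.E i u (v a)) ∧
            ∀ a, GradedEquiv M M' m (v a) (v' a))

namespace GradedEquiv

variable {I J W W' : Type*} {M : KripkeStructure I J W} {M' : KripkeStructure I J W'}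

theorem symm {m : ℕ} {u : W} {u' : W'} (h : GradedEquiv M M' m u u') :
    GradedEquiv M' M m u' u := by
  induction m generalizing u u' with
  | zero => exact fun j => (h j).symm
  | succ m ih =>
    refine ⟨ih h.1, fun i k hk v hv hE => ?_, fun i k hk v hv hE => ?_⟩
    · obtain ⟨w, hw, hEw, hs⟩ := h.2.2 i k hk v hv hE
      exact ⟨w, hw, hEw, fun a => ih (hs a)⟩
    · obtain ⟨w, hw, hEw, hs⟩ := h.2.1 i k hk v hv hE
      exact ⟨w, hw, hEw, fun a => ih (hs a)⟩

theorem mono {l m : ℕ} (hlm : l ≤ m) {u : W} {u' : W'} (h : GradedEquiv M M' m u u') :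
    GradedEquiv M M' l u u' := by
  induction m, hlm using Nat.le_induction with
  | base => exact h
  | succ m _ ih => exact ih h.1

/-- A single answer to a challenge that is good at each level up to `N` at which the two worlds are
equivalent. -/
theorem exists_uniform_answer {u : W} {u' : W'} {i : I} {k : ℕ} {v : Fin k → W}
    (hv : Function.Injective v) (hE : ∀ a, M.E i u (v a)) (N : ℕ) :
    ∃ v' : Fin k → W', ∀ m < N, k ≤ m + 1 → GradedEquiv M M' (m + 1) u u' →
      Function.Injective v' ∧ (∀ a, M'.E i u' (v' a)) ∧ ∀ a, GradedEquiv M M' m (v a) (v' a) := by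
  induction N with
  | zero => exact ⟨fun _ => u', fun m hm => absurd hm (Nat.not_lt_zero m)⟩
  | succ N ih =>
    by_cases h : k ≤ N + 1 ∧ GradedEquiv M M' (N + 1) u u'
    · obtain ⟨v', hv', hE', hs⟩ := h.2.2.1 i k h.1 v hv hE
      exact ⟨v', fun m hm _ _ => ⟨hv', hE', fun a => (hs a).mono (Nat.lt_succ_iff.1 hm)⟩⟩
    · obtain ⟨v', hv'⟩ := ih
      refine ⟨v', fun m hm hk hm' => ?_⟩
      rcases Nat.lt_succ_iff_lt_or_eq.1 hm with hlt | rfl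
      · exact hv' m hlt hk hm'
      · exact absurd ⟨hk, hm'⟩ h

end GradedEquiv

/-! ### Finite Boolean combinations and characteristic formulae -/

namespace GradedModalFormula

theorem exists_finite_conj {I : Type u} {J : Type v} {F : Set (GradedModalFormula I J)}
    (hF : F.Finite) :
    ∃ χ : GradedModalFormula I J, ∀ (W : Type x) (M : KripkeStructure I J W) (w : W),
      M.Sat w χ ↔ ∀ f ∈ F, M.Sat w f := by
  induction F, hF using Set.Finite.induction_on with
  | empty => exact ⟨.top, fun W M w => by simp [KripkeStructure.Sat]⟩
  | @insert f F _ _ ih =>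
    obtain ⟨χ, hχ⟩ := ih
    exact ⟨.and f χ, fun W M w => by simp [KripkeStructure.Sat, hχ]⟩

theorem exists_finite_disj {I : Type u} {J : Type v} {F : Set (GradedModalFormula I J)}
    (hF : F.Finite) :
    ∃ χ : GradedModalFormula I J, ∀ (W : Type x) (M : KripkeStructure I J W) (w : W),
      M.Sat w χ ↔ ∃ f ∈ F, M.Sat w f := by
  obtain ⟨χ, hχ⟩ := exists_finite_conj.{u, v, x} (hF.image neg)
  exact ⟨.neg χ, fun W M w => by simp [KripkeStructure.Sat, hχ]⟩

/-- The characteristic formula of a subset `S` of a finite set `F` of formulae: among the members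
of `F`, exactly those in `S` hold. -/
theorem exists_characteristic {I : Type u} {J : Type v} {F : Set (GradedModalFormula I J)}
    (hF : F.Finite) (S : Set (GradedModalFormula I J)) :
    ∃ χ : GradedModalFormula I J, ∀ (W : Type x) (M : KripkeStructure I J W) (w : W),
      M.Sat w χ ↔ ∀ f ∈ F, (M.Sat w f ↔ f ∈ S) := by
  classical
  obtain ⟨χ, hχ⟩ := exists_finite_conj.{u, v, x} (hF.image fun f => if f ∈ S then f else neg f)
  refine ⟨χ, fun W M w => ?_⟩
  rw [hχ, Set.forall_mem_image]
  refine forall₂_congr fun f _ => ?_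
  by_cases h : f ∈ S <;> simp [h, KripkeStructure.Sat]

end GradedModalFormula

/-! ### Finitely many formulae guarantee equivalence at a given level -/

/-- If the counting formulae `◇^{≥ k} χ_S` transfer from `u` to `u'`, where `χ_S` ranges over the
characteristic formulae of the subsets of `F`, then each short tuple of distinct successors of `u`
is matched by such a tuple at `u'`, with componentwise agreement on `F`. The tuple is matched
separately within each class of components that satisfy the same members of `F`; the parts do not
overlap, as different characteristic formulae exclude each other. -/
theorem exists_matching_tuple {I : Type u} {J : Type v} {F : Set (GradedModalFormula I J)}
    {χ : Set (GradedModalFormula I J) → GradedModalFormula I J}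
    (hχ : ∀ S (W : Type x) (M : KripkeStructure I J W) (w : W),
      M.Sat w (χ S) ↔ ∀ f ∈ F, (M.Sat w f ↔ f ∈ S))
    {W W' : Type x} {M : KripkeStructure I J W} {M' : KripkeStructure I J W'} {u : W} {u' : W'}
    {i : I} {n : ℕ}
    (h : ∀ (k : ℕ) (hk : 1 ≤ k), k ≤ n → ∀ S ⊆ F,
      M.Sat u (.dia i k hk (χ S)) → M'.Sat u' (.dia i k hk (χ S)))
    {k : ℕ} (hkn : k ≤ n) {v : Fin k → W} (hv : Function.Injective v)
    (hE : ∀ a, M.E i u (v a)) :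
    ∃ v' : Fin k → W', Function.Injective v' ∧ (∀ a, M'.E i u' (v' a)) ∧
      ∀ a, ∀ f ∈ F, (M.Sat (v a) f ↔ M'.Sat (v' a) f) := by
  classical
  let T : Fin k → Set (GradedModalFormula I J) := fun a => {f | f ∈ F ∧ M.Sat (v a) f}
  have key : ∀ S, ∃ g : {a // T a = S} → W', Function.Injective g ∧
      ∀ a, g a ∈ {w | M'.E i u' w ∧ M'.Sat w (χ S)} := by
    intro S
    rcases isEmpty_or_nonempty {a // T a = S} with hS | ⟨⟨a₀, ha₀⟩⟩
    · exact ⟨isEmptyElim, fun a => isEmptyElim a, fun a => isEmptyElim a⟩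
    · rw [← card_le_encard_iff_exists_injective]
      refine h _ (Fintype.card_pos_iff.2 ⟨⟨a₀, ha₀⟩⟩) ?_ S ?_ ?_
      · exact (Fintype.card_subtype_le _).trans (by simpa using hkn)
      · rw [← ha₀]
        exact fun f hf => hf.1
      · simp only [KripkeStructure.Sat]
        rw [card_le_encard_iff_exists_injective]
        refine ⟨fun a => v a, hv.comp Subtype.val_injective, fun a => ⟨hE a, ?_⟩⟩
        obtain ⟨a, rfl⟩ := a
        rw [hχ]
        exact fun f hf => ⟨fun hs => ⟨hf, hs⟩, fun hs => hs.2⟩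
  choose g hg hgs using key
  have hagree : ∀ a, ∀ f ∈ F, (M.Sat (v a) f ↔ M'.Sat (g (T a) ⟨a, rfl⟩) f) := by
    intro a f hf
    rw [(hχ _ _ _ _).1 (hgs (T a) ⟨a, rfl⟩).2 f hf]
    exact ⟨fun hs => ⟨hf, hs⟩, fun hs => hs.2⟩
  refine ⟨fun a => g (T a) ⟨a, rfl⟩, fun a b hab => ?_, fun a => (hgs (T a) ⟨a, rfl⟩).1, hagree⟩
  have hab' : g (T a) ⟨a, rfl⟩ = g (T b) ⟨b, rfl⟩ := hab
  have hT : T a = T b := by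
    ext f
    refine and_congr_right fun hf => ?_
    rw [hagree a f hf, hagree b f hf, hab']
  have hcast : ∀ S (hS : T b = S), g (T b) ⟨b, rfl⟩ = g S ⟨b, hS⟩ := by
    rintro _ rfl
    rfl
  rw [hcast (T a) hT.symm] at hab'
  exact congrArg Subtype.val (hg (T a) hab')

theorem exists_finite_forall_gradedEquiv {I : Type u} {J : Type v} [Finite I] [Finite J] (m : ℕ) :
    ∃ F : Set (GradedModalFormula I J), F.Finite ∧
      ∀ (W W' : Type x) (M : KripkeStructure I J W) (M' : KripkeStructure I J W') (u : W) (u' : W'),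
        (∀ f ∈ F, (M.Sat u f ↔ M'.Sat u' f)) → GradedEquiv M M' m u u' := by
  induction m with
  | zero =>
    exact ⟨Set.range .prop, Set.finite_range _, fun W W' M M' u u' h j => h _ ⟨j, rfl⟩⟩
  | succ m ih =>
    obtain ⟨F, hF, hequiv⟩ := ih
    choose χ hχ using GradedModalFormula.exists_characteristic.{u, v, x} hF
    have : Finite (𝒫 F) := hF.finite_subsets
    let d : I × Fin (m + 1) × 𝒫 F → GradedModalFormula I J :=
      fun p => .dia p.1 (p.2.1 + 1) (Nat.le_add_left _ _) (χ p.2.2)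
    have hd : ∀ (i : I) (k : ℕ) (hk : 1 ≤ k), k ≤ m + 1 → ∀ S ⊆ F,
        .dia i k hk (χ S) ∈ Set.range d := by
      intro i k hk hkm S hS
      obtain ⟨k, rfl⟩ := Nat.exists_eq_add_of_le' hk
      exact ⟨(i, ⟨k, hkm⟩, ⟨S, hS⟩), rfl⟩
    refine ⟨F ∪ Set.range d, hF.union (Set.finite_range d), fun W W' M M' u u' h => ?_⟩
    refine ⟨hequiv _ _ _ _ _ _ fun f hf => h f (.inl hf), fun i k hk v hv hE => ?_,
      fun i k hk v hv hE => ?_⟩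
    · obtain ⟨v', hv', hE', hs⟩ := exists_matching_tuple (M' := M') (u' := u') hχ
        (fun l hl hlm S hS => (h _ (.inr (hd i l hl hlm S hS))).1) hk hv hE
      exact ⟨v', hv', hE', fun a => hequiv _ _ _ _ _ _ (hs a)⟩
    · obtain ⟨v', hv', hE', hs⟩ := exists_matching_tuple (M' := M) (u' := u) hχ
        (fun l hl hlm S hS => (h _ (.inr (hd i l hl hlm S hS))).2) hk hv hE
      exact ⟨v', hv', hE', fun a => hequiv _ _ _ _ _ _ fun f hf => (hs a f hf).symm⟩

/-- A property of pointed structures that is invariant under agreement on finitely many formulae is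
defined by a graded modal formula. -/
theorem exists_formula_of_finite_agreement {I : Type u} {J : Type v}
    {F : Set (GradedModalFormula I J)} (hF : F.Finite)
    (p : ∀ W : Type x, KripkeStructure I J W → W → Prop)
    (hp : ∀ (W W' : Type x) (M : KripkeStructure I J W) (M' : KripkeStructure I J W') (u : W)
      (u' : W'), (∀ f ∈ F, (M.Sat u f ↔ M'.Sat u' f)) → p W M u → p W' M' u') :
    ∃ ψ : GradedModalFormula I J, ∀ (W : Type x) (M : KripkeStructure I J W) (w : W),
      p W M w ↔ M.Sat w ψ := by
  choose χ hχ using GradedModalFormula.exists_characteristic.{u, v, x} hF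
  obtain ⟨ψ, hψ⟩ := GradedModalFormula.exists_finite_disj.{u, v, x}
    ((hF.finite_subsets.subset (Set.sep_subset (𝒫 F) fun S =>
      ∃ (W : Type x) (M : KripkeStructure I J W) (w : W), M.Sat w (χ S) ∧ p W M w)).image χ)
  refine ⟨ψ, fun W M w => ?_⟩
  rw [hψ, Set.exists_mem_image]
  constructor
  · intro h
    have hw : M.Sat w (χ {f | f ∈ F ∧ M.Sat w f}) := by
      rw [hχ]
      exact fun f hf => ⟨fun hs => ⟨hf, hs⟩, fun hs => hs.2⟩
    exact ⟨_, ⟨fun f hf => hf.1, W, M, w, hw, h⟩, hw⟩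
  · rintro ⟨S, ⟨-, W₀, M₀, w₀, hw₀, h₀⟩, hw⟩
    rw [hχ] at hw₀ hw
    exact hp _ _ M₀ M w₀ w (fun f hf => (hw₀ f hf).trans (hw f hf).symm) h₀

/-! ### Ultraproducts of Kripke structures -/

section Ultraproduct

variable {I J ι : Type*} {W W' : ι → Type*} (U : Ultrafilter ι)

/-- The ultraproduct of a family of Kripke structures, read off from Mathlib's ultraproduct of the
corresponding first-order structures. -/
def KripkeStructure.ultraproduct (M : ∀ n, KripkeStructure I J (W n)) :
    KripkeStructure I J ((U : Filter ι).Product W) :=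
  letI := fun n => (M n).toStructure
  { E := fun i a b => FirstOrder.Language.Structure.RelMap (L := modalLanguage I J)
      (ModalRelation.acc i : ModalRelation I J 2) ![a, b]
    P := fun j a => FirstOrder.Language.Structure.RelMap (L := modalLanguage I J)
      (ModalRelation.prop j : ModalRelation I J 1) ![a] }

variable {U} {M : ∀ n, KripkeStructure I J (W n)} {M' : ∀ n, KripkeStructure I J (W' n)}

theorem KripkeStructure.ultraproduct_E (i : I) (f g : ∀ n, W n) :
    (KripkeStructure.ultraproduct U M).E i (f : (U : Filter ι).Product W) g ↔
      ∀ᶠ n in U, (M n).E i (f n) (g n) := by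
  let _ := fun n => (M n).toStructure
  have hfg : (![(f : (U : Filter ι).Product W), (g : (U : Filter ι).Product W)]) =
      fun c => ((![f, g] c : ∀ n, W n) : (U : Filter ι).Product W) := by
    funext c
    fin_cases c <;> rfl
  change FirstOrder.Language.Structure.RelMap (L := modalLanguage I J)
    (ModalRelation.acc i : ModalRelation I J 2)
    ![(f : (U : Filter ι).Product W), (g : (U : Filter ι).Product W)] ↔ _
  rw [hfg]
  exact FirstOrder.Language.relMap_quotient_mk' ((U : Filter ι).productSetoid W)
    (L := modalLanguage I J) (ModalRelation.acc i : ModalRelation I J 2) ![f, g]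

theorem KripkeStructure.ultraproduct_P (j : J) (f : ∀ n, W n) :
    (KripkeStructure.ultraproduct U M).P j (f : (U : Filter ι).Product W) ↔
      ∀ᶠ n in U, (M n).P j (f n) := by
  let _ := fun n => (M n).toStructure
  have hf : (![(f : (U : Filter ι).Product W)]) =
      fun c => ((![f] c : ∀ n, W n) : (U : Filter ι).Product W) := by
    funext c
    fin_cases c
    rfl
  change FirstOrder.Language.Structure.RelMap (L := modalLanguage I J)
    (ModalRelation.prop j : ModalRelation I J 1) ![(f : (U : Filter ι).Product W)] ↔ _
  rw [hf]
  exact FirstOrder.Language.relMap_quotient_mk' ((U : Filter ι).productSetoid W)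
    (L := modalLanguage I J) (ModalRelation.prop j : ModalRelation I J 1) ![f]

theorem KripkeStructure.toStructure_ultraproduct :
    (KripkeStructure.ultraproduct U M).toStructure =
      letI := fun n => (M n).toStructure
      FirstOrder.Language.Ultraproduct.structure := by
  refine FirstOrder.Language.Structure.ext ?_ ?_
  · funext n f
    exact Empty.elim f
  · funext n R xs
    cases R with
    | prop j =>
      have hxs : xs = ![xs 0] := by
        funext c
        fin_cases c
        rfl
      conv_rhs => rw [hxs]
      rfl
    | acc i =>
      have hxs : xs = ![xs 0, xs 1] := by
        funext c
        fin_cases c <;> rfl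
      conv_rhs => rw [hxs]
      rfl

/-- Łoś's theorem for pointed Kripke structures. -/
theorem KripkeStructure.satFO_ultraproduct (f : ∀ n, W n)
    (φ : (modalLanguage I J).Formula (Fin 1)) :
    (KripkeStructure.ultraproduct U M).SatFO (f : (U : Filter ι).Product W) φ ↔
      ∀ᶠ n in U, (M n).SatFO (f n) φ := by
  have : ∀ n, Nonempty (W n) := fun n => ⟨f n⟩
  let _ := fun n => (M n).toStructure
  change @FirstOrder.Language.Formula.Realize _ _
    (KripkeStructure.ultraproduct U M).toStructure _ φ _ ↔ _
  rw [KripkeStructure.toStructure_ultraproduct]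
  exact FirstOrder.Language.Ultraproduct.realize_formula_cast φ fun _ => f

/-! ### Approximate equivalence in the components yields bisimilar ultraproducts -/

/-- Two elements of ultraproducts are related if they have representatives which, for each `m`, are
`m`-equivalent in almost all components. -/
def UltraEquiv (U : Ultrafilter ι) (M : ∀ n, KripkeStructure I J (W n))
    (M' : ∀ n, KripkeStructure I J (W' n)) (a : (U : Filter ι).Product W)
    (b : (U : Filter ι).Product W') : Prop :=
  ∃ (f : ∀ n, W n) (g : ∀ n, W' n), a = f ∧ b = g ∧
    ∀ m, ∀ᶠ n in U, GradedEquiv (M n) (M' n) m (f n) (g n)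

theorem UltraEquiv.symm {a : (U : Filter ι).Product W} {b : (U : Filter ι).Product W'}
    (h : UltraEquiv U M M' a b) : UltraEquiv U M' M b a := by
  obtain ⟨f, g, hf, hg, h⟩ := h
  exact ⟨g, f, hg, hf, fun m => (h m).mono fun n hn => hn.symm⟩

end Ultraproduct

section HyperfilterProduct

variable {I J : Type*} {W W' : ℕ → Type*} {M : ∀ n, KripkeStructure I J (W n)}
  {M' : ∀ n, KripkeStructure I J (W' n)}

/-- In the component `n`, the answer is taken at the highest level below `n` at which the components
are equivalent; this level tends to infinity along the ultrafilter. -/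
theorem UltraEquiv.forth {a : (hyperfilter ℕ : Filter ℕ).Product W}
    {b : (hyperfilter ℕ : Filter ℕ).Product W'} (h : UltraEquiv (hyperfilter ℕ) M M' a b) (i : I)
    {k : ℕ} {v : Fin k → (hyperfilter ℕ : Filter ℕ).Product W} (hv : Function.Injective v)
    (hE : ∀ c, (KripkeStructure.ultraproduct _ M).E i a (v c)) :
    ∃ v' : Fin k → (hyperfilter ℕ : Filter ℕ).Product W', Function.Injective v' ∧
      (∀ c, (KripkeStructure.ultraproduct _ M').E i b (v' c)) ∧
        ∀ c, UltraEquiv (hyperfilter ℕ) M M' (v c) (v' c) := by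
  classical
  obtain ⟨f, g, rfl, rfl, hfg⟩ := h
  obtain ⟨r, rfl⟩ : ∃ r : Fin k → ∀ n, W n, v = fun c => (r c : Product _ W) :=
    ⟨fun c => (v c).out, funext fun c => (Quotient.out_eq (v c)).symm⟩
  simp only [KripkeStructure.ultraproduct_E] at hE
  have hinj : ∀ᶠ n in hyperfilter ℕ, Function.Injective fun c => r c n := by
    have : ∀ c d, ∀ᶠ n in hyperfilter ℕ, r c n = r d n → c = d := by
      intro c d
      by_cases hcd : c = d
      · exact Eventually.of_forall fun _ _ => hcd
      · have hne : ¬ ∀ᶠ n in hyperfilter ℕ, r c n = r d n :=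
          fun he => hcd (hv (Quotient.sound he))
        exact (Ultrafilter.eventually_not.2 hne).mono fun n hn he => absurd he hn
    exact (eventually_all.2 fun c => eventually_all.2 fun d => this c d).mono fun n hn c d => hn c d
  have hEall : ∀ᶠ n in hyperfilter ℕ, ∀ c, (M n).E i (f n) (r c n) := eventually_all.2 hE
  have hans : ∀ n, ∃ v' : Fin k → W' n, (Function.Injective fun c => r c n) →
      (∀ c, (M n).E i (f n) (r c n)) → ∀ m < n, k ≤ m + 1 →
        GradedEquiv (M n) (M' n) (m + 1) (f n) (g n) → Function.Injective v' ∧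
          (∀ c, (M' n).E i (g n) (v' c)) ∧ ∀ c, GradedEquiv (M n) (M' n) m (r c n) (v' c) := by
    intro n
    by_cases hn : (Function.Injective fun c => r c n) ∧ ∀ c, (M n).E i (f n) (r c n)
    · obtain ⟨v', hv'⟩ := GradedEquiv.exists_uniform_answer (M' := M' n) (u' := g n) hn.1 hn.2 n
      exact ⟨v', fun _ _ => hv'⟩
    · exact ⟨fun _ => g n, fun h₁ h₂ => absurd ⟨h₁, h₂⟩ hn⟩
  choose s hs using hans
  have hgood : ∀ m, ∀ᶠ n in hyperfilter ℕ, Function.Injective (s n) ∧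
      (∀ c, (M' n).E i (g n) (s n c)) ∧ ∀ c, GradedEquiv (M n) (M' n) m (r c n) (s n c) := by
    intro m
    have hlarge : ∀ᶠ n in hyperfilter ℕ, m + k < n :=
      Nat.hyperfilter_le_atTop (eventually_gt_atTop (m + k))
    filter_upwards [hlarge, hinj, hEall, hfg (m + k + 1)] with n hn h₁ h₂ h₃
    obtain ⟨hi, he, hz⟩ := hs n h₁ h₂ (m + k) hn (by lia) h₃
    exact ⟨hi, he, fun c => (hz c).mono (Nat.le_add_right m k)⟩
  refine ⟨fun c => ((fun n => s n c : ∀ n, W' n) : Product _ W'), fun c d hcd => ?_, fun c => ?_,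
    fun c => ⟨_, _, rfl, rfl, fun m => (hgood m).mono fun n hn => hn.2.2 c⟩⟩
  · have he : ∀ᶠ n in hyperfilter ℕ, s n c = s n d := Quotient.exact hcd
    obtain ⟨n, hn, hn'⟩ := ((hgood 0).and he).exists
    exact hn.1 hn'
  · rw [KripkeStructure.ultraproduct_E]
    exact (hgood 0).mono fun n hn => hn.2.1 c

theorem isGradedBisimulation_ultraproduct
    (hne : ∃ a b, UltraEquiv (hyperfilter ℕ) M M' a b) :
    IsGradedBisimulation (KripkeStructure.ultraproduct (hyperfilter ℕ) M)
      (KripkeStructure.ultraproduct (hyperfilter ℕ) M') (UltraEquiv (hyperfilter ℕ) M M') where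
  nonempty := hne
  atoms := by
    rintro _ _ ⟨f, g, rfl, rfl, h⟩ j
    rw [KripkeStructure.ultraproduct_P, KripkeStructure.ultraproduct_P]
    exact eventually_congr ((h 0).mono fun n hn => hn j)
  forth _ _ h i _ _ _ hv hE := h.forth i hv hE
  back _ _ h i _ _ _ hv hE := by
    obtain ⟨v, hv, hE, hs⟩ := h.symm.forth i hv hE
    exact ⟨v, hv, hE, fun c => (hs c).symm⟩

end HyperfilterProduct

/-! ### The characterisation -/

/-- Invariance under graded bisimulation already gives invariance under a finite approximation. -/
theorem exists_gradedEquiv_invariant {I : Type u} {J : Type v}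
    {φ : (modalLanguage I J).Formula (Fin 1)}
    (h : ∀ (W W' : Type x) (M : KripkeStructure I J W) (M' : KripkeStructure I J W') (w : W)
      (w' : W'), GradedBisimilar M w M' w' → (M.SatFO w φ ↔ M'.SatFO w' φ)) :
    ∃ m, ∀ (W W' : Type x) (M : KripkeStructure I J W) (M' : KripkeStructure I J W') (w : W)
      (w' : W'), GradedEquiv M M' m w w' → M.SatFO w φ → M'.SatFO w' φ := by
  by_contra! hcon
  choose W W' M M' w w' hequiv hsat hnot using hcon
  have hZ : UltraEquiv (hyperfilter ℕ) M M' w w' := by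
    refine ⟨w, w', rfl, rfl, fun m => ?_⟩
    have hlarge : ∀ᶠ n in hyperfilter ℕ, m ≤ n :=
      Nat.hyperfilter_le_atTop (eventually_ge_atTop m)
    exact hlarge.mono fun n hn => (hequiv n).mono hn
  have hiff := h _ _ _ _ _ _ ⟨_, isGradedBisimulation_ultraproduct ⟨_, _, hZ⟩, hZ⟩
  rw [KripkeStructure.satFO_ultraproduct, KripkeStructure.satFO_ultraproduct] at hiff
  obtain ⟨n, hn⟩ := (hiff.1 (Eventually.of_forall hsat)).exists
  exact hnot n hn

theorem theorem1 {I : Type u} {J : Type v} [Finite I] [Finite J]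
    (φ : (modalLanguage I J).Formula (Fin 1)) :
    (∀ (W W' : Type x) (M : KripkeStructure I J W) (M' : KripkeStructure I J W') (w : W) (w' : W'),
      GradedBisimilar M w M' w' → (M.SatFO w φ ↔ M'.SatFO w' φ)) ↔
    ∃ ψ : GradedModalFormula I J,
      ∀ (W : Type x) (M : KripkeStructure I J W) (w : W), M.SatFO w φ ↔ M.Sat w ψ := by
  constructor
  · intro h
    obtain ⟨m, hm⟩ := exists_gradedEquiv_invariant h
    obtain ⟨F, hF, hequiv⟩ := exists_finite_forall_gradedEquiv.{u, v, x} (I := I) (J := J) m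
    exact exists_formula_of_finite_agreement hF (fun _ M w => M.SatFO w φ)
      fun W W' M M' w w' hF => hm W W' M M' w w' (hequiv W W' M M' w w' hF)
  · rintro ⟨ψ, hψ⟩ W W' M M' w w' ⟨Z, hZ, hww'⟩
    rw [hψ, hψ]
    exact hZ.sat_iff ψ hww'
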